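/- Let $n>k\ge 0$ be integers with either $n\ge k+2$ or $(n,k)=(1,0)$, and put $m_1=\binom{n-2}{k-1}$, $m_2=\binom{n-2}{k}$, $m_3=\binom{n-1}{k}$ (with $m_1=0$ if $k=0$, and $m_2=1$ if $(n,k)=(1,0)$). Let $T$ be a $k$-dimensional $\mathbb{Q}$-acyclic simplicial complex on $[n]=\{1,\dots,n\}$, that is, a simplicial complex of dimension at most $k$ on $[n]$ with a full $(k-1)$-skeleton, with exactly $\binom{n-1}{k}$ faces of dimension $k$, and with $\tilde H_k(T)=0$. For $i\in[n]$ let $d_i$ be the number of $k$-dimensional faces of $T$ that contain the vertex $i$. Then the reduced integral homology group $\tilde H_{k-1}(T)$ is finite and, with $0^0$ understood to be $1$, $$|\tilde H_{k-1}(T)|^2\le\frac{\prod_{i\in[n]}(d_i-m_1)^{m_1-d_i}}{m_2^{m_1}}\left(\frac{\sum_{i\in[n]}d_i^2}{m_3}-(k+1)m_1\right)^{m_3}.$$ -/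

import Mathlib

namespace QAcyclic

/-- The sign `(-1) ^ m` of the vertex `v = τ_m` in `τ = {τ_0 < τ_1 < ...}`: here `m` is the number
of vertices of `τ` that are smaller than `v`. -/
def sign {n : ℕ} (τ : Finset (Fin n)) (v : Fin n) : ℤ :=
  (-1) ^ (τ.filter (· < v)).card

/-- The simplicial boundary map on the free abelian group on all finite subsets of the vertex set,
`∂ τ = ∑ₘ (-1) ^ m • (τ \ {τ_m})`. It sends the empty set to `0` and a single vertex to the empty
set (augmentation). -/
noncomputable def boundary (n : ℕ) : (Finset (Fin n) →₀ ℤ) →ₗ[ℤ] (Finset (Fin n) →₀ ℤ) :=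
  Finsupp.lsum ℤ fun τ => LinearMap.toSpanSingleton ℤ (Finset (Fin n) →₀ ℤ)
    (∑ v ∈ τ, Finsupp.single (τ.erase v) (sign τ v))

/-- The faces of `K` with exactly `j` vertices (that is, of dimension `j - 1`). The empty set
counts as a face, the only one with `0` vertices. -/
def facesOfCard {n : ℕ} (K : PreAbstractSimplicialComplex (Fin n)) (j : ℕ) :
    Set (Finset (Fin n)) :=
  {s | s.card = j ∧ (s = ∅ ∨ s ∈ K)}

/-- The group of augmented simplicial chains of `K` of dimension `j - 1`. -/
noncomputable def chains {n : ℕ} (K : PreAbstractSimplicialComplex (Fin n)) (j : ℕ) :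
    Submodule ℤ (Finset (Fin n) →₀ ℤ) :=
  Finsupp.supported ℤ ℤ (facesOfCard K j)

/-- Reduced cycles of dimension `j - 1`. -/
noncomputable def cycles {n : ℕ} (K : PreAbstractSimplicialComplex (Fin n)) (j : ℕ) :
    Submodule ℤ (Finset (Fin n) →₀ ℤ) :=
  chains K j ⊓ LinearMap.ker (boundary n)

/-- Reduced boundaries of dimension `j - 1`. -/
noncomputable def boundaries {n : ℕ} (K : PreAbstractSimplicialComplex (Fin n)) (j : ℕ) :
    Submodule ℤ (Finset (Fin n) →₀ ℤ) :=
  (chains K (j + 1)).map (boundary n)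

theorem boundary_single {n : ℕ} (τ : Finset (Fin n)) (c : ℤ) :
    boundary n (Finsupp.single τ c)
      = c • ∑ v ∈ τ, Finsupp.single (τ.erase v) (sign τ v) := by
  simp [boundary]

theorem sign_erase {n : ℕ} (τ : Finset (Fin n)) (v w : Fin n) (hv : v ∈ τ)
    (h : v < w) : sign τ v * sign (τ.erase v) w = -(sign τ w * sign (τ.erase w) v) := by
  have h1 : ((τ.erase w).filter (· < v)) = τ.filter (· < v) := by
    ext x
    simp only [Finset.mem_filter, Finset.mem_erase]
    exact ⟨fun hx => ⟨hx.1.2, hx.2⟩, fun hx => ⟨⟨(hx.2.trans h).ne, hx.1⟩, hx.2⟩⟩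
  have h2 : ((τ.erase v).filter (· < w)) = (τ.filter (· < w)).erase v := by
    ext x
    simp only [Finset.mem_filter, Finset.mem_erase]
    tauto
  have h3 : (((τ.filter (· < w)).erase v).card) + 1 = (τ.filter (· < w)).card :=
    Finset.card_erase_add_one (by simp [hv, h])
  unfold sign
  rw [h1, h2, ← h3, pow_succ]
  ring

theorem boundary_boundary {n : ℕ} (x : Finset (Fin n) →₀ ℤ) :
    boundary n (boundary n x) = 0 := by
  induction x using Finsupp.induction_linear with
  | zero => simp
  | add f g hf hg => simp [hf, hg]
  | single τ c =>
    rw [boundary_single, map_smul, map_sum]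
    have : ∑ v ∈ τ, boundary n (Finsupp.single (τ.erase v) (sign τ v)) = 0 := by
      simp only [boundary_single, Finset.smul_sum, Finsupp.smul_single, smul_eq_mul]
      rw [Finset.sum_sigma']
      refine Finset.sum_involution (fun p _ => ⟨p.2, p.1⟩) ?_ ?_ ?_ ?_
      · rintro ⟨v, w⟩ hp
        simp only [Finset.mem_sigma, Finset.mem_erase] at hp
        obtain ⟨hv, hwv, hw⟩ := hp
        rw [Finset.erase_right_comm, ← Finsupp.single_add]
        rcases lt_or_gt_of_ne hwv with h | h
        · rw [sign_erase τ w v hw h]; simp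
        · rw [sign_erase τ v w hv h]; simp
      · rintro ⟨v, w⟩ hp _ heq
        simp only [Finset.mem_sigma, Finset.mem_erase] at hp
        simp only [Sigma.mk.injEq] at heq
        exact hp.2.1 heq.1
      · rintro ⟨v, w⟩ hp
        simp only [Finset.mem_sigma, Finset.mem_erase] at hp ⊢
        exact ⟨hp.2.2, fun h => hp.2.1 h.symm, hp.1⟩
      · rintro ⟨v, w⟩ _
        rfl
    rw [this, smul_zero]

theorem boundaries_le_cycles {n : ℕ} (K : PreAbstractSimplicialComplex (Fin n)) (j : ℕ) :
    boundaries K j ≤ cycles K j := by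
  rintro _ ⟨x, hx, rfl⟩
  refine ⟨?_, boundary_boundary x⟩
  have hx' : x ∈ Finsupp.supported ℤ ℤ (facesOfCard K (j + 1)) := hx
  rw [Finsupp.supported_eq_span_single] at hx'
  induction hx' using Submodule.span_induction with
  | mem y hy =>
    obtain ⟨τ, hτ, rfl⟩ := hy
    rw [boundary_single, one_smul]
    refine Submodule.sum_mem _ fun v hv => Finsupp.single_mem_supported ℤ _ ?_
    refine ⟨by rw [Finset.card_erase_of_mem hv, hτ.1]; rfl, ?_⟩
    rcases (τ.erase v).eq_empty_or_nonempty with h | h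
    · exact Or.inl h
    · right
      rcases hτ.2 with h0 | h0
      · simp [h0] at hv
      · exact (K.isRelLowerSet_faces h0).2 (Finset.erase_subset v τ) h
  | zero => simp
  | add y z hy hz h1 h2 =>
    rw [← Finsupp.supported_eq_span_single] at hy hz
    rw [map_add]; exact add_mem (h1 hy) (h2 hz)
  | smul a y hy h1 =>
    rw [← Finsupp.supported_eq_span_single] at hy
    rw [map_smul]; exact Submodule.smul_mem _ a (h1 hy)

/-- The reduced integral simplicial homology group of `K` in dimension `j - 1`, i.e.
`H̃_{j-1}(K; ℤ)`. -/
abbrev ReducedHomology {n : ℕ} (K : PreAbstractSimplicialComplex (Fin n)) (j : ℕ) : Type :=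
  cycles K j ⧸ (boundaries K j).submoduleOf (cycles K j)

/-- `K` is a `k`-dimensional `ℚ`-acyclic simplicial complex on the vertex set `Fin n`: it has
dimension at most `k`, a full `(k - 1)`-skeleton, exactly `(n - 1).choose k` faces of dimension `k`,
and `H̃_k(K) = 0`. -/
structure IsQAcyclic {n : ℕ} (k : ℕ) (K : PreAbstractSimplicialComplex (Fin n)) : Prop where
  card_le : ∀ s ∈ K, s.card ≤ k + 1
  full_skeleton : ∀ s : Finset (Fin n), s.Nonempty → s.card ≤ k → s ∈ K
  card_faces : (facesOfCard K (k + 1)).ncard = (n - 1).choose k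
  homology_eq_zero : Subsingleton (ReducedHomology K (k + 1))

/-- The number of `k`-dimensional faces of `K` that contain the vertex `i`. -/
noncomputable def degree {n : ℕ} (k : ℕ) (K : PreAbstractSimplicialComplex (Fin n))
    (i : Fin n) : ℕ :=
  {s ∈ facesOfCard K (k + 1) | i ∈ s}.ncard

/-- `m₁ = binom (n - 2) (k - 1)`, with `binom (n - 2) (-1) = 0`. -/
def m₁ (n : ℕ) : ℕ → ℕ
  | 0 => 0
  | k + 1 => (n - 2).choose k

/-- `m₂ = binom (n - 2) k` (for `n = 1`, `k = 0` this is `binom (-1) 0 = 1`). -/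
def m₂ (n k : ℕ) : ℕ := (n - 2).choose k

/-- `m₃ = binom (n - 1) k`. -/
def m₃ (n k : ℕ) : ℕ := (n - 1).choose k

end QAcyclic

/-! Fix a vertex `o`. Let `A` be the block of the boundary matrix with rows the `k`-sets avoiding
`o` and columns the `k`-faces of `T`. It is square of size `m₃`, and coning from `o` shows that its
column lattice has index `|H̃_{k-1}(T)|` in `ℤ^m₃`, so `|H̃_{k-1}(T)| = |det A|`
(`card_reducedHomology`).

Give vertex `i` weight `√xᵢ`, let `D` be the weighted boundary matrix, and let `G` be the block of
`Dᵀ D` on the faces of `T`. The trace of `G` is `∑ dᵢ xᵢ`, so AM-GM on its eigenvalues bounds `det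
G`. On the other hand `det G` is known exactly: `G` factors through `coneGram`, whose only possible
eigenvalues are `∑ xᵢ` and `xₒ`, to the powers `m₁` and `m₂` in the determinant (`det_coneGram`),
while the weighted block differs from `A` by diagonal scalings. This yields `det_sq_mul_le` for all
positive weights. Letting one weight tend to `0` forces `dᵢ ≥ m₁`, and then `xᵢ = dᵢ - m₁`, whose
sum is `m₂`, gives the bound. -/

section

open Finset Matrix Filter Topology

/-! ### Anticommutation relations of the signed vertex removals -/

namespace QAcyclic

variable {n : ℕ} {R : Type*} [CommRing R]

/-- The matrix of the contraction that removes the vertex `i`. -/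
def removal (R : Type*) [CommRing R] (i : Fin n) :
    Matrix (Finset (Fin n)) (Finset (Fin n)) R :=
  Matrix.of fun τ σ => if i ∈ σ ∧ σ.erase i = τ then (sign σ i : R) else 0

/-- The matrix of the boundary map in which the removal of the vertex `i` has weight `v i`. -/
def contraction (v : Fin n → R) : Matrix (Finset (Fin n)) (Finset (Fin n)) R :=
  ∑ i, v i • removal R i

theorem sign_mul_self (τ : Finset (Fin n)) (i : Fin n) : sign τ i * sign τ i = 1 := by
  rw [sign, ← mul_pow]; simp

theorem cast_sign_mul_self (τ : Finset (Fin n)) (i : Fin n) :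
    (sign τ i : R) * (sign τ i : R) = 1 := by
  rw [← Int.cast_mul, sign_mul_self, Int.cast_one]

theorem sign_insert_self (τ : Finset (Fin n)) (i : Fin n) : sign (insert i τ) i = sign τ i := by
  simp [sign, Finset.filter_insert]

theorem sign_erase_self (τ : Finset (Fin n)) (i : Fin n) : sign (τ.erase i) i = sign τ i := by
  have : (τ.erase i).filter (· < i) = τ.filter (· < i) := by
    ext x; simp only [mem_filter, mem_erase]; exact ⟨fun h => ⟨h.1.2, h.2⟩, fun h => ⟨⟨h.2.ne, h.1⟩, h.2⟩⟩
  simp [sign, this]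

theorem sign_mul_sign_erase {τ : Finset (Fin n)} {i j : Fin n} (hi : i ∈ τ) (hj : j ∈ τ)
    (h : i ≠ j) :
    sign τ i * sign (τ.erase i) j = -(sign τ j * sign (τ.erase j) i) := by
  rcases lt_or_gt_of_ne h with h | h
  · exact sign_erase τ i j hi h
  · rw [sign_erase τ j i hj h, neg_neg]

theorem removal_mul_apply (i : Fin n) (M : Matrix (Finset (Fin n)) (Finset (Fin n)) R)
    (τ ρ : Finset (Fin n)) :
    (removal R i * M) τ ρ = if i ∈ τ then 0 else (sign τ i : R) * M (insert i τ) ρ := by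
  rw [Matrix.mul_apply]
  split_ifs with h
  · refine Finset.sum_eq_zero fun σ _ => ?_
    rw [removal, Matrix.of_apply, if_neg, zero_mul]
    rintro ⟨_, rfl⟩
    exact Finset.notMem_erase i σ h
  · rw [Finset.sum_eq_single (insert i τ)]
    · simp [removal, Finset.erase_insert h, sign_insert_self]
    · intro σ _ hσ
      rw [removal, Matrix.of_apply, if_neg, zero_mul]
      rintro ⟨hi, rfl⟩
      exact hσ (Finset.insert_erase hi).symm
    · simp

theorem removal_transpose_mul_apply (i : Fin n)
    (M : Matrix (Finset (Fin n)) (Finset (Fin n)) R) (σ ρ : Finset (Fin n)) :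
    ((removal R i)ᵀ * M) σ ρ = if i ∈ σ then (sign σ i : R) * M (σ.erase i) ρ else 0 := by
  rw [Matrix.mul_apply]
  split_ifs with h
  · rw [Finset.sum_eq_single (σ.erase i)]
    · simp [removal, h]
    · intro τ _ hτ
      rw [Matrix.transpose_apply, removal, Matrix.of_apply, if_neg, zero_mul]
      exact fun h' => hτ h'.2.symm
    · simp
  · refine Finset.sum_eq_zero fun τ _ => ?_
    rw [Matrix.transpose_apply, removal, Matrix.of_apply, if_neg, zero_mul]
    exact fun h' => h h'.1

theorem removal_mul_removal_add (i j : Fin n) :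
    removal R i * removal R j + removal R j * removal R i = 0 := by
  ext τ ρ
  have e : ∀ a b : Fin n, removal R a * removal R b = removal R a * (removal R b * 1) := by simp
  rw [Matrix.add_apply, e, e, removal_mul_apply, removal_mul_apply, removal_mul_apply,
    removal_mul_apply]
  by_cases hij : i = j
  · subst hij; simp
  by_cases hi : i ∈ τ
  · simp [hi]
  by_cases hj : j ∈ τ
  · simp [hj]
  simp only [hi, hj, if_false, Finset.mem_insert, hij, Ne.symm hij, or_self]
  rw [Finset.insert_comm j i, ← mul_assoc, ← mul_assoc, ← add_mul, ← Int.cast_mul, ← Int.cast_mul,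
    ← Int.cast_add]
  have h := sign_mul_sign_erase (τ := insert i (insert j τ)) (i := i) (j := j) (by simp) (by simp) hij
  have h' : sign (insert i (insert j τ)) j = sign (insert i τ) j := by
    rw [Finset.insert_comm, sign_insert_self]
  have h'' : (insert i (insert j τ)).erase j = insert i τ := by
    rw [Finset.insert_comm, Finset.erase_insert (by simp [hj, Ne.symm hij])]
  rw [Finset.erase_insert (by simp [hi, hij]), h', h'', sign_insert_self, sign_insert_self,
    sign_insert_self] at h
  rw [show sign τ i * sign (insert i τ) j + sign τ j * sign (insert j τ) i = 0 by linarith]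
  simp

theorem removal_mul_removal_transpose_add (i j : Fin n) :
    removal R i * (removal R j)ᵀ + (removal R j)ᵀ * removal R i = if i = j then 1 else 0 := by
  ext τ ρ
  have e1 : (removal R i * (removal R j)ᵀ) = removal R i * ((removal R j)ᵀ * 1) := by simp
  have e2 : ((removal R j)ᵀ * removal R i) = (removal R j)ᵀ * (removal R i * 1) := by simp
  rw [Matrix.add_apply, e1, e2, removal_mul_apply, removal_transpose_mul_apply,
    removal_transpose_mul_apply, removal_mul_apply]
  by_cases hij : i = j
  · subst hij
    by_cases hi : i ∈ τ
    · simp only [hi, if_true, Finset.mem_erase, ne_eq, not_true, false_and, if_false, sign_erase_self,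
        ← mul_assoc, cast_sign_mul_self, zero_add, one_mul]
      exact congrArg (fun x => (1 : Matrix (Finset (Fin n)) (Finset (Fin n)) R) x ρ)
        (Finset.insert_erase hi)
    · simp only [hi, if_true, if_false, Finset.mem_insert, true_or, sign_insert_self,
        ← mul_assoc, cast_sign_mul_self, add_zero, one_mul]
      exact congrArg (fun x => (1 : Matrix (Finset (Fin n)) (Finset (Fin n)) R) x ρ)
        (Finset.erase_insert hi)
  simp only [hij, if_false, Finset.mem_insert, Ne.symm hij, false_or, Finset.mem_erase, ne_eq,
    not_false_eq_true, true_and, Matrix.zero_apply]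
  by_cases hi : i ∈ τ
  · simp [hi]
  by_cases hj : j ∈ τ
  swap
  · simp [hj]
  simp only [hi, hj, if_true, if_false]
  rw [Finset.erase_insert_of_ne hij, ← mul_assoc, ← mul_assoc, ← add_mul,
    ← Int.cast_mul, ← Int.cast_mul, ← Int.cast_add]
  have h := sign_mul_sign_erase (τ := insert i τ) (i := i) (j := j) (by simp) (by simp [hj]) hij
  rw [Finset.erase_insert hi, sign_insert_self, Finset.erase_insert_of_ne hij, sign_insert_self] at h
  have h1 := sign_mul_self τ i
  have h2 := sign_mul_self τ j
  have h3 := sign_mul_self (insert i τ) j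
  have : sign τ i * sign (insert i τ) j + sign τ j * sign (τ.erase j) i = 0 := by
    -- The relation `h` becomes `a * b = -(c * d)`; multiplying by `b * c` and using `b² = c² = 1`
    -- gives the claim.
    generalize sign τ i = a at *
    generalize sign τ j = b at *
    generalize sign (insert i τ) j = c at *
    generalize sign (τ.erase j) i = d at *
    linear_combination (b * c) * h - a * c * h2 - b * d * h3
  rw [this]; simp

/-- Contraction by `v` and exterior multiplication by `w` anticommute to the scalar `⟨v, w⟩`. -/
theorem contraction_mul_transpose_add (v w : Fin n → R) :
    contraction v * (contraction w)ᵀ + (contraction w)ᵀ * contraction v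
      = (∑ i, v i * w i) • (1 : Matrix _ _ R) := by
  have : ∀ i j, (v i • removal R i) * (w j • (removal R j)ᵀ)
      + (w j • (removal R j)ᵀ) * (v i • removal R i) = if i = j then (v i * w j) • 1 else 0 := by
    intro i j
    have h := congrArg ((v i * w j) • ·) (removal_mul_removal_transpose_add (R := R) i j)
    simp only [smul_add, smul_ite, smul_zero] at h
    rw [← h]
    simp [smul_smul, mul_comm]
  simp only [contraction, Matrix.transpose_sum, Matrix.transpose_smul, Finset.sum_mul_sum]
  rw [Finset.sum_comm (s := univ) (t := univ)
    (f := fun i j => (w i • (removal R i)ᵀ) * (v j • removal R j)), ← Finset.sum_add_distrib]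
  simp only [← Finset.sum_add_distrib, this, Finset.sum_ite_eq, Finset.mem_univ, if_true,
    Finset.sum_smul]

theorem contraction_mul_add (v w : Fin n → R) :
    contraction v * contraction w + contraction w * contraction v = 0 := by
  have : ∀ i j, (v i • removal R i) * (w j • removal R j)
      + (w j • removal R j) * (v i • removal R i) = 0 := by
    intro i j
    have h := congrArg ((v i * w j) • ·) (removal_mul_removal_add (R := R) i j)
    simp only [smul_add, smul_zero] at h
    rw [← h]
    simp [smul_smul, mul_comm]
  simp only [contraction, Finset.sum_mul_sum]
  rw [Finset.sum_comm (s := univ) (t := univ)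
    (f := fun i j => (w i • removal R i) * (v j • removal R j)), ← Finset.sum_add_distrib]
  simp only [← Finset.sum_add_distrib, this, Finset.sum_const_zero]

theorem contraction_mul_self (v : Fin n → ℝ) : contraction v * contraction v = 0 := by
  have h := contraction_mul_add v v
  rw [← two_smul ℝ] at h
  exact (smul_eq_zero.mp h).resolve_left two_ne_zero

theorem contraction_apply (v : Fin n → R) (τ σ : Finset (Fin n)) :
    contraction v τ σ = ∑ i ∈ σ, if σ.erase i = τ then v i * (sign σ i : R) else 0 := by
  rw [contraction, Matrix.sum_apply, ← Finset.sum_subset (Finset.subset_univ σ)]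
  · refine Finset.sum_congr rfl fun i hi => ?_
    simp [removal, hi]
  · intro i _ hi
    simp [removal, hi]

theorem contraction_single (o : Fin n) : contraction (Pi.single o (1 : R)) = removal R o := by
  rw [contraction, Finset.sum_eq_single o]
  · simp
  · intro i _ hi; simp [Pi.single_eq_of_ne hi]
  · simp

theorem contraction_apply_eq_zero (v : Fin n → R) {τ σ : Finset (Fin n)}
    (h : τ.card + 1 ≠ σ.card) : contraction v τ σ = 0 := by
  rw [contraction_apply]
  refine Finset.sum_eq_zero fun i hi => if_neg ?_
  rintro rfl
  exact h (Finset.card_erase_add_one hi)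

/-- Where the entry is nonzero, `σ` is `τ` plus one vertex `i`, and the weight `v i` is the ratio of
the two products. Hence weighting only rescales rows and columns. -/
theorem contraction_apply_mul_prod (v : Fin n → R) (τ σ : Finset (Fin n)) :
    contraction v τ σ * ∏ i ∈ τ, v i = contraction 1 τ σ * ∏ i ∈ σ, v i := by
  rw [contraction_apply, contraction_apply, Finset.sum_mul, Finset.sum_mul]
  refine Finset.sum_congr rfl fun i hi => ?_
  split_ifs with h
  · subst h
    rw [← Finset.mul_prod_erase σ v hi, Pi.one_apply]; ring
  · simp

theorem contraction_gram_diag (v : Fin n → R) (σ : Finset (Fin n)) :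
    ((contraction v)ᵀ * contraction v) σ σ = ∑ i ∈ σ, v i ^ 2 := by
  rw [contraction, Matrix.transpose_sum, Finset.sum_mul, Matrix.sum_apply,
    ← Finset.sum_subset (Finset.subset_univ σ)]
  · refine Finset.sum_congr rfl fun i hi => ?_
    rw [← contraction, Matrix.transpose_smul, Matrix.smul_mul, Matrix.smul_apply,
      removal_transpose_mul_apply, if_pos hi, contraction_apply, Finset.sum_eq_single_of_mem i hi]
    · rw [if_pos rfl]
      linear_combination (norm := (simp only [smul_eq_mul]; ring)) v i ^ 2 * cast_sign_mul_self (R := R) σ i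
    · intro j hj hji
      rw [if_neg]
      intro h
      have : i ∈ σ.erase j := Finset.mem_erase.mpr ⟨hji.symm, hi⟩
      rw [h] at this
      simp at this
  · intro i _ hi
    rw [Matrix.transpose_smul, Matrix.smul_mul, Matrix.smul_apply, removal_transpose_mul_apply, if_neg hi,
      smul_zero]

theorem map_contraction_one (τ σ : Finset (Fin n)) :
    ((contraction (1 : Fin n → ℤ) τ σ : ℤ) : R) = contraction 1 τ σ := by
  simp [contraction_apply]

end QAcyclic

/-! ### Determinants from spectra, and the quadratic equation of the cone Gram matrix -/

namespace QAcyclic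

variable {n : ℕ} {F : Type*} [Fintype F] [DecidableEq F]

/-- Every eigenvalue is `a` or `b`; if these differ, size and trace determine the two
multiplicities. -/
theorem det_eq_pow_mul_pow_of_quadratic {H : Matrix F F ℝ} (hH : H.IsHermitian) {a b : ℝ}
    {p q : ℕ} (hquad : H * H = (a + b) • H - (a * b) • 1) (hpq : p + q = Fintype.card F)
    (htr : H.trace = p * a + q * b) : H.det = a ^ p * b ^ q := by
  have hev : ∀ j, hH.eigenvalues j = a ∨ hH.eigenvalues j = b := by
    intro j
    have h1 := hH.mulVec_eigenvectorBasis j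
    have hv : (hH.eigenvectorBasis j).ofLp ≠ 0 := by
      intro h0
      exact hH.eigenvectorBasis.toBasis.ne_zero j (by ext i; simpa using congrFun h0 i)
    have h2 := congrArg (· *ᵥ (hH.eigenvectorBasis j).ofLp) hquad
    simp only [← Matrix.mulVec_mulVec, Matrix.sub_mulVec, Matrix.smul_mulVec, h1,
      Matrix.mulVec_smul, Matrix.one_mulVec, smul_smul, ← sub_smul] at h2
    have h3 := smul_left_injective ℝ hv h2
    have : (hH.eigenvalues j - a) * (hH.eigenvalues j - b) = 0 := by linear_combination h3
    rcases mul_eq_zero.mp this with h | h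
    · left; linarith
    · right; linarith
  have hdet : H.det = ∏ i, hH.eigenvalues i := by simpa using hH.det_eq_prod_eigenvalues
  have htr' : H.trace = ∑ i, hH.eigenvalues i := by simpa using hH.trace_eq_sum_eigenvalues
  rcases eq_or_ne a b with rfl | hab
  · rw [hdet, Finset.prod_congr rfl fun i _ => (hev i).elim id id, Finset.prod_const,
      Finset.card_univ, ← hpq, pow_add]
  classical
  set P := univ.filter fun j => hH.eigenvalues j = a
  have hcard : (P.card : ℝ) + (univ.filter fun j => ¬ hH.eigenvalues j = a).card = p + q := by
    exact_mod_cast (Finset.card_filter_add_card_filter_not _).trans hpq.symm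
  have hb : ∀ j ∈ univ.filter (fun j => ¬ hH.eigenvalues j = a), hH.eigenvalues j = b :=
    fun j hj => (hev j).resolve_left (Finset.mem_filter.mp hj).2
  have ha : ∀ j ∈ P, hH.eigenvalues j = a := fun j hj => (Finset.mem_filter.mp hj).2
  rw [htr, ← Finset.sum_filter_add_sum_filter_not univ (fun j => hH.eigenvalues j = a),
    Finset.sum_congr rfl ha, Finset.sum_congr rfl hb, Finset.sum_const, Finset.sum_const,
    nsmul_eq_mul, nsmul_eq_mul] at htr'
  rw [hdet, ← Finset.prod_filter_mul_prod_filter_not univ (fun j => hH.eigenvalues j = a),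
    Finset.prod_congr rfl ha, Finset.prod_congr rfl hb, Finset.prod_const, Finset.prod_const]
  have hp : (P.card : ℝ) = p := by
    have : ((P.card : ℝ) - p) * (a - b) = 0 := by linear_combination -htr' - b * hcard
    rcases mul_eq_zero.mp this with h | h
    · linarith
    · exact absurd (by linarith) hab
  have hq : ((univ.filter fun j => ¬ hH.eigenvalues j = a).card : ℝ) = q := by linarith
  rw [Nat.cast_inj.mp hp, Nat.cast_inj.mp hq]

/-- AM-GM for the eigenvalues. -/
theorem det_le_trace_div_card_pow {G : Matrix F F ℝ} (hG : G.PosSemidef) [Nonempty F] :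
    G.det ≤ (G.trace / Fintype.card F) ^ Fintype.card F := by
  have hdet : G.det = ∏ i, hG.1.eigenvalues i := by simpa using hG.1.det_eq_prod_eigenvalues
  have htr : G.trace = ∑ i, hG.1.eigenvalues i := by simpa using hG.1.trace_eq_sum_eigenvalues
  have hF : (0 : ℝ) < Fintype.card F := by exact_mod_cast Fintype.card_pos
  have h := Real.geom_mean_le_arith_mean univ (fun _ => 1) hG.1.eigenvalues (by simp)
    (by simpa using Fintype.card_pos) (fun i _ => hG.eigenvalues_nonneg i)
  simp only [Real.rpow_one, Finset.sum_const, Finset.card_univ, nsmul_eq_mul, mul_one,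
    one_mul] at h
  rw [hdet, htr]
  have h0 : 0 ≤ ∏ i, hG.1.eigenvalues i := Finset.prod_nonneg fun i _ => hG.eigenvalues_nonneg i
  calc _ = ((∏ i, hG.1.eigenvalues i) ^ ((Fintype.card F : ℝ)⁻¹)) ^ Fintype.card F := by
        rw [Real.rpow_inv_natCast_pow h0 Fintype.card_ne_zero]
    _ ≤ _ := pow_le_pow_left₀ (Real.rpow_nonneg h0 _) h _

/-- The Gram matrix of the weighted boundaries of the cones with apex `o`. -/
def coneGram (v : Fin n → ℝ) (o : Fin n) : Matrix (Finset (Fin n)) (Finset (Fin n)) ℝ :=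
  removal ℝ o * (contraction v)ᵀ * contraction v * (removal ℝ o)ᵀ

theorem removal_mul_contraction_transpose_add {R : Type*} [CommRing R] (v : Fin n → R)
    (o : Fin n) :
    removal R o * (contraction v)ᵀ + (contraction v)ᵀ * removal R o = v o • (1 : Matrix _ _ R) := by
  rw [← contraction_single, contraction_mul_transpose_add]
  simp [Pi.single_apply]

theorem contraction_mul_removal_transpose_add {R : Type*} [CommRing R] (v : Fin n → R)
    (o : Fin n) :
    contraction v * (removal R o)ᵀ + (removal R o)ᵀ * contraction v = v o • (1 : Matrix _ _ R) := by
  rw [← contraction_single, contraction_mul_transpose_add]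
  simp [Pi.single_apply]

/-- The last factor is the identity on sets avoiding `o`, so there the roots of the quadratic are `∑
i, v i ^ 2` and `v o ^ 2`. -/
theorem coneGram_mul_self (v : Fin n → ℝ) (o : Fin n) :
    coneGram v o * coneGram v o = (∑ i, v i ^ 2 + v o ^ 2) • coneGram v o
      - ((∑ i, v i ^ 2) * v o ^ 2) • (removal ℝ o * (removal ℝ o)ᵀ) := by
  have h1 := removal_mul_contraction_transpose_add v o
  have h2 := contraction_mul_removal_transpose_add v o
  have h3 := contraction_mul_transpose_add v v
  have h4 := contraction_mul_self v
  have h5 := removal_mul_removal_transpose_add (R := ℝ) o o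
  have h6 : removal ℝ o * contraction v = - (contraction v * removal ℝ o) := by
    rw [← contraction_single]; exact eq_neg_of_add_eq_zero_left (contraction_mul_add _ _)
  have h7 : (removal ℝ o)ᵀ * (contraction v)ᵀ = - ((contraction v)ᵀ * (removal ℝ o)ᵀ) := by
    have := congrArg Matrix.transpose h6
    simp only [Matrix.transpose_mul, Matrix.transpose_neg] at this
    rw [this, neg_neg]
  have h8 : removal ℝ o * removal ℝ o = 0 := by
    rw [← contraction_single]; exact contraction_mul_self _
  have h9 : (removal ℝ o)ᵀ * (removal ℝ o)ᵀ = 0 := by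
    rw [← Matrix.transpose_mul, h8, Matrix.transpose_zero]
  have h10 : (contraction v)ᵀ * (contraction v)ᵀ = 0 := by
    rw [← Matrix.transpose_mul, h4, Matrix.transpose_zero]
  simp only [← pow_two] at h3
  simp only [if_true] at h5
  unfold coneGram
  -- Only the anticommutation relations matter from here on; `e` and `E` become the transposes of
  -- `d` and `D`.
  generalize (∑ i, v i ^ 2) = S at *
  generalize v o = t at *
  generalize removal ℝ o = d at *
  generalize contraction v = D at *
  generalize dᵀ = e at *
  generalize Dᵀ = E at *
  have k1 : d * E * D * d = (-t) • (d * D) := by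
    calc d * E * D * d = -(d * E * (d * D)) := by
          rw [h6, mul_neg, neg_neg]; noncomm_ring
      _ = -(((d * E + E * d) * (d * D)) - E * (d * d) * D) := by noncomm_ring
      _ = _ := by rw [h1, h8]; simp
  have k2 : e * E * D * e = (-t) • (E * e) := by
    calc e * E * D * e = -(E * (e * (D * e))) := by rw [h7]; noncomm_ring
      _ = -(E * (e * (D * e + e * D)) - E * (e * e) * D) := by noncomm_ring
      _ = _ := by rw [h2, h9]; simp
  have k3 : D * E * D = S • D := by
    calc D * E * D = D * (D * E + E * D) - D * D * E := by noncomm_ring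
      _ = _ := by rw [h3, h4]; simp
  -- The middle `e * d` is replaced by `1 - d * e`. The first part collapses by `D * E * D = S • D`,
  -- the second by `k1` and `k2`.
  calc d * E * D * e * (d * E * D * e)
      = d * E * D * (d * e + e * d) * (E * D * e) - (d * E * D * d) * (e * E * D * e) := by
        noncomm_ring
    _ = d * E * (D * E * D) * e - (t * t) • (d * (D * E + E * D) * e - d * E * D * e) := by
        rw [h5, k1, k2, smul_mul_smul_comm, neg_mul_neg]; noncomm_ring
    _ = _ := by
        rw [k3, h3]
        simp only [mul_smul_comm, smul_mul_assoc, mul_one]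
        module

end QAcyclic

/-! ### Restriction to `k`-sets avoiding the apex, and the weighted determinant inequality -/

namespace QAcyclic

variable {n : ℕ} {F : Type*} [Fintype F]

theorem coneGram_transpose (v : Fin n → ℝ) (o : Fin n) : (coneGram v o)ᵀ = coneGram v o := by
  simp [coneGram, Matrix.transpose_mul, Matrix.mul_assoc]

theorem coneGram_apply (v : Fin n → ℝ) (o : Fin n) (τ ρ : Finset (Fin n)) :
    coneGram v o τ ρ = if o ∈ τ then 0 else (sign τ o : ℝ) * (if o ∈ ρ then 0 else
      (sign ρ o : ℝ) * ((contraction v)ᵀ * contraction v) (insert o τ) (insert o ρ)) := by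
  have e1 : coneGram v o
      = removal ℝ o * (removal ℝ o * ((contraction v)ᵀ * contraction v))ᵀ := by
    simp [coneGram, Matrix.transpose_mul, Matrix.mul_assoc]
  rw [e1, removal_mul_apply, Matrix.transpose_apply, removal_mul_apply]
  congr! 3
  have : ((contraction v)ᵀ * contraction v)ᵀ = (contraction v)ᵀ * contraction v := by
    simp [Matrix.transpose_mul]
  rw [← Matrix.transpose_apply ((contraction v)ᵀ * contraction v), this]

theorem gram_apply_eq_zero (v : Fin n → ℝ) {σ σ' : Finset (Fin n)} (h : σ.card ≠ σ'.card) :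
    ((contraction v)ᵀ * contraction v) σ σ' = 0 := by
  rw [Matrix.mul_apply]
  refine Finset.sum_eq_zero fun τ _ => ?_
  by_cases h1 : τ.card + 1 = σ.card
  · rw [contraction_apply_eq_zero v (τ := τ) (σ := σ') (by omega), mul_zero]
  · rw [Matrix.transpose_apply, contraction_apply_eq_zero v h1, zero_mul]

theorem coneGram_apply_eq_zero (v : Fin n → ℝ) (o : Fin n) {τ ρ : Finset (Fin n)}
    (h : ¬ (ρ.card = τ.card ∧ o ∉ ρ)) : coneGram v o τ ρ = 0 := by
  rw [coneGram_apply]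
  split_ifs with h1 h2
  · rfl
  · simp
  · rw [gram_apply_eq_zero, mul_zero, mul_zero]
    rw [Finset.card_insert_of_notMem h1, Finset.card_insert_of_notMem h2]
    exact fun h3 => h ⟨by omega, h2⟩

theorem coneGram_diag (v : Fin n → ℝ) {o : Fin n} {τ : Finset (Fin n)} (h : o ∉ τ) :
    coneGram v o τ τ = v o ^ 2 + ∑ i ∈ τ, v i ^ 2 := by
  rw [coneGram_apply, if_neg h, if_neg h, ← mul_assoc, cast_sign_mul_self, one_mul,
    contraction_gram_diag, Finset.sum_insert h]

theorem removal_mul_transpose_apply {o : Fin n} {τ : Finset (Fin n)} (h : o ∉ τ)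
    (ρ : Finset (Fin n)) :
    (removal ℝ o * (removal ℝ o)ᵀ) τ ρ = (1 : Matrix (Finset (Fin n)) (Finset (Fin n)) ℝ) τ ρ := by
  have e1 : (removal ℝ o * (removal ℝ o)ᵀ) = removal ℝ o * ((removal ℝ o)ᵀ * 1) := by simp
  rw [e1, removal_mul_apply, if_neg h, removal_transpose_mul_apply, if_pos (by simp),
    sign_insert_self, ← mul_assoc, cast_sign_mul_self, one_mul, Finset.erase_insert h]

theorem coneGram_mul_submatrix {m : Type*} (v : Fin n → ℝ) {o : Fin n} {k : ℕ}
    {e : F → Finset (Fin n)} (he : Function.Injective e)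
    (hrange : ∀ τ, τ ∈ Set.range e ↔ τ.card = k ∧ o ∉ τ)
    (M : Matrix (Finset (Fin n)) (Finset (Fin n)) ℝ) (c : m → Finset (Fin n)) :
    (coneGram v o * M).submatrix e c = (coneGram v o).submatrix e e * M.submatrix e c := by
  ext f g
  simp only [Matrix.submatrix_apply, Matrix.mul_apply]
  symm
  refine Fintype.sum_of_injective e he _ _ (fun τ hτ => ?_) (fun _ => rfl)
  rw [hrange] at hτ
  rw [coneGram_apply_eq_zero, zero_mul]
  rwa [((hrange (e f)).mp ⟨f, rfl⟩).1]

/-- Since `D * D = 0`, coning from `o` between two copies of `D` gives `D * (removal ℝ o)ᵀ * D = v o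
• D`. Both factors of `Dᵀ * D` are expanded this way. -/
theorem smul_gram_eq (v : Fin n → ℝ) (o : Fin n) :
    v o ^ 2 • ((contraction v)ᵀ * contraction v)
      = (contraction v)ᵀ * (coneGram v o * contraction v) := by
  have h2 := contraction_mul_removal_transpose_add v o
  have h4 := contraction_mul_self v
  have key : contraction v * (removal ℝ o)ᵀ * contraction v = v o • contraction v := by
    calc _ = (contraction v * (removal ℝ o)ᵀ + (removal ℝ o)ᵀ * contraction v) * contraction v
          - (removal ℝ o)ᵀ * (contraction v * contraction v) := by noncomm_ring
      _ = _ := by rw [h2, h4]; simp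
  have key' := congrArg Matrix.transpose key
  simp only [Matrix.transpose_mul, Matrix.transpose_transpose, Matrix.transpose_smul] at key'
  calc _ = (v o • (contraction v)ᵀ) * (v o • contraction v) := by
        rw [smul_mul_smul_comm, pow_two]
    _ = _ := by rw [← key, ← key']; simp [coneGram, Matrix.mul_assoc]

theorem gram_submatrix_eq (v : Fin n → ℝ) {o : Fin n} {k : ℕ}
    {e : F → Finset (Fin n)} (he : Function.Injective e)
    (hrange : ∀ τ, τ ∈ Set.range e ↔ τ.card = k ∧ o ∉ τ)
    {s : F → Finset (Fin n)} (hs : ∀ f, (s f).card = k + 1) :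
    v o ^ 2 • ((contraction v)ᵀ * contraction v).submatrix s s
      = ((contraction v).submatrix e s)ᵀ
        * ((coneGram v o).submatrix e e * (contraction v).submatrix e s) := by
  rw [← coneGram_mul_submatrix v he hrange]
  change (v o ^ 2 • ((contraction v)ᵀ * contraction v)).submatrix s s = _
  rw [smul_gram_eq v o]
  ext f g
  simp only [Matrix.submatrix_apply, Matrix.mul_apply (M := (contraction v)ᵀ),
    Matrix.mul_apply (M := ((contraction v).submatrix e s)ᵀ)]
  symm
  refine Fintype.sum_of_injective e he _ _ (fun τ hτ => ?_) (fun _ => rfl)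
  -- Summands outside the block vanish: a wrong cardinality kills the left factor, and `o ∈ τ` kills
  -- the row of `coneGram`.
  rw [hrange, not_and_or, not_not] at hτ
  rcases hτ with hτ | hτ
  · rw [Matrix.transpose_apply, contraction_apply_eq_zero v (by rw [hs]; omega), zero_mul]
  · rw [← coneGram_transpose, Matrix.mul_apply]
    rw [Finset.sum_eq_zero, mul_zero]
    intro ρ _
    rw [Matrix.transpose_apply, coneGram_apply_eq_zero _ _ (fun h => h.2 hτ), zero_mul]

theorem m₁_add_m₂ {n k : ℕ} (hkn : k < n) : m₁ n k + m₂ n k = m₃ n k := by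
  rcases k with _ | k
  · simp [m₁, m₂, m₃]
  · obtain ⟨m, rfl⟩ : ∃ m, n = m + 2 := ⟨n - 2, by omega⟩
    exact (Nat.choose_succ_succ m k).symm

section Counting

variable {o : Fin n} {k : ℕ} {e : F → Finset (Fin n)}

theorem card_eq_m₃ (he : Function.Injective e)
    (hrange : ∀ τ, τ ∈ Set.range e ↔ τ.card = k ∧ o ∉ τ) : Fintype.card F = m₃ n k := by
  classical
  have h : univ.image e = powersetCard k (univ.erase o) := by
    ext τ
    simpa [Finset.mem_powersetCard, Finset.subset_erase, and_comm] using hrange τ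
  rw [← Finset.card_univ, ← Finset.card_image_of_injective univ he, h, Finset.card_powersetCard,
    Finset.card_erase_of_mem (Finset.mem_univ o), Finset.card_univ, Fintype.card_fin, m₃]

theorem card_filter_mem_eq_m₁ (hkn : k < n) (he : Function.Injective e)
    (hrange : ∀ τ, τ ∈ Set.range e ↔ τ.card = k ∧ o ∉ τ) {i : Fin n} (hi : i ≠ o) :
    (univ.filter fun f => i ∈ e f).card = m₁ n k := by
  classical
  have h : (univ.filter fun f => i ∉ e f).image e
      = powersetCard k ((univ.erase o).erase i) := by
    ext τ
    have := hrange τ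
    simp only [Set.mem_range] at this
    simp only [Finset.mem_image, Finset.mem_filter, Finset.mem_univ, true_and,
      Finset.mem_powersetCard, Finset.subset_erase, Finset.subset_univ]
    constructor
    · rintro ⟨f, hf, rfl⟩
      have := this.mp ⟨f, rfl⟩
      exact ⟨⟨this.2, hf⟩, this.1⟩
    · rintro ⟨⟨h1, h2⟩, h3⟩
      obtain ⟨f, rfl⟩ := this.mpr ⟨h3, h1⟩
      exact ⟨f, h2, rfl⟩
  have h' := congrArg Finset.card h
  rw [Finset.card_image_of_injective _ he, Finset.card_powersetCard,
    Finset.card_erase_of_mem (by simp [hi]), Finset.card_erase_of_mem (Finset.mem_univ o),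
    Finset.card_univ, Fintype.card_fin, Nat.sub_sub] at h'
  have h1 := m₁_add_m₂ hkn
  have h2 := Finset.card_filter_add_card_filter_not (s := (univ : Finset F)) (fun f => i ∈ e f)
  rw [Finset.card_univ, card_eq_m₃ he hrange] at h2
  change _ = m₂ n k at h'
  omega

theorem card_filter_apex_mem (hrange : ∀ τ, τ ∈ Set.range e ↔ τ.card = k ∧ o ∉ τ) :
    (univ.filter fun f => o ∈ e f).card = 0 := by
  rw [Finset.card_eq_zero, Finset.filter_eq_empty_iff]
  exact fun f _ => ((hrange (e f)).mp ⟨f, rfl⟩).2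

theorem sum_sum_mem_eq (s : F → Finset (Fin n)) (x : Fin n → ℝ) :
    ∑ f, ∑ i ∈ s f, x i = ∑ i, ((univ.filter fun f => i ∈ s f).card : ℝ) * x i := by
  calc _ = ∑ f, ∑ i, if i ∈ s f then x i else 0 := by simp
    _ = _ := by
      rw [Finset.sum_comm]
      refine Finset.sum_congr rfl fun i _ => ?_
      rw [← Finset.sum_filter, Finset.sum_const, nsmul_eq_mul]

theorem prod_prod_mem_eq (s : F → Finset (Fin n)) (x : Fin n → ℝ) :
    ∏ f, ∏ i ∈ s f, x i = ∏ i, x i ^ (univ.filter fun f => i ∈ s f).card := by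
  calc _ = ∏ f, ∏ i, if i ∈ s f then x i else 1 := by simp
    _ = _ := by
      rw [Finset.prod_comm]
      refine Finset.prod_congr rfl fun i _ => ?_
      rw [← Finset.prod_filter, Finset.prod_const]

/-- The diagonal entries are `v o ^ 2 + ∑ i ∈ τ, v i ^ 2`, and each `i ≠ o` lies in `m₁` of the
sets. The trace is thus `m₁ * ∑ i, v i ^ 2 + m₂ * v o ^ 2`, which fixes the exponents. -/
theorem det_coneGram [DecidableEq F] (v : Fin n → ℝ) (hkn : k < n) (he : Function.Injective e)
    (hrange : ∀ τ, τ ∈ Set.range e ↔ τ.card = k ∧ o ∉ τ) :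
    ((coneGram v o).submatrix e e).det = (∑ i, v i ^ 2) ^ m₁ n k * (v o ^ 2) ^ m₂ n k := by
  refine det_eq_pow_mul_pow_of_quadratic ?_ ?_ ?_ ?_
  · rw [Matrix.IsHermitian, Matrix.conjTranspose_eq_transpose_of_trivial,
      Matrix.transpose_submatrix, coneGram_transpose]
  · rw [← coneGram_mul_submatrix v he hrange, coneGram_mul_self]
    ext f g
    simp only [Matrix.submatrix_apply, Matrix.sub_apply, Matrix.smul_apply,
      removal_mul_transpose_apply ((hrange (e f)).mp ⟨f, rfl⟩).2, Matrix.one_apply, he.eq_iff]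
  · rw [card_eq_m₃ he hrange, m₁_add_m₂ hkn]
  · have h1 : ((coneGram v o).submatrix e e).trace
        = ∑ f, (v o ^ 2 + ∑ i ∈ e f, v i ^ 2) := by
      refine Finset.sum_congr rfl fun f _ => ?_
      exact coneGram_diag v ((hrange (e f)).mp ⟨f, rfl⟩).2
    rw [h1, Finset.sum_add_distrib, sum_sum_mem_eq, Finset.sum_const, Finset.card_univ,
      card_eq_m₃ he hrange, ← m₁_add_m₂ hkn, ← Finset.add_sum_erase univ _ (Finset.mem_univ o),
      card_filter_apex_mem hrange, ← Finset.add_sum_erase univ (fun i => v i ^ 2) (Finset.mem_univ o)]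
    rw [Finset.sum_congr rfl fun i hi => by
      rw [card_filter_mem_eq_m₁ hkn he hrange (Finset.mem_erase.mp hi).1], ← Finset.mul_sum]
    simp only [nsmul_eq_mul]
    push_cast
    ring

theorem det_sq_mul_le [DecidableEq F] (hkn : k < n) (he : Function.Injective e)
    (hrange : ∀ τ, τ ∈ Set.range e ↔ τ.card = k ∧ o ∉ τ)
    {s : F → Finset (Fin n)} (hs : ∀ f, (s f).card = k + 1) {x : Fin n → ℝ} (hx : ∀ i, 0 < x i) :
    (((contraction (1 : Fin n → ℤ)).submatrix e s).det : ℝ) ^ 2 * (∑ i, x i) ^ m₁ n k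
        * ∏ i, x i ^ (univ.filter fun f => i ∈ s f).card
      ≤ (∏ i, x i ^ m₁ n k)
        * ((∑ i, ((univ.filter fun f => i ∈ s f).card : ℝ) * x i) / m₃ n k) ^ m₃ n k := by
  set v : Fin n → ℝ := fun i => √(x i)
  have hv2 : ∀ i, v i ^ 2 = x i := fun i => Real.sq_sqrt (hx i).le
  have hcard := card_eq_m₃ he hrange
  have hm₃ : 0 < m₃ n k := Nat.choose_pos (by omega)
  have : Nonempty F := Fintype.card_pos_iff.mp (by omega)
  set G := ((contraction v)ᵀ * contraction v).submatrix s s with hG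
  set B := (contraction v).submatrix e s with hB
  set A := (contraction (1 : Fin n → ℤ)).submatrix e s with hA
  have hpsd : G.PosSemidef := by
    have := (Matrix.posSemidef_conjTranspose_mul_self (contraction v)).submatrix s
    rwa [Matrix.conjTranspose_eq_transpose_of_trivial] at this
  have htr : G.trace = ∑ i, ((univ.filter fun f => i ∈ s f).card : ℝ) * x i := by
    rw [← sum_sum_mem_eq]
    refine Finset.sum_congr rfl fun f _ => ?_
    rw [hG, Matrix.diag_apply, Matrix.submatrix_apply, contraction_gram_diag]
    exact Finset.sum_congr rfl fun i _ => hv2 i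
  have hle := det_le_trace_div_card_pow hpsd
  rw [htr, hcard] at hle
  have hdet := congrArg Matrix.det (gram_submatrix_eq v he hrange hs)
  rw [Matrix.det_smul, Matrix.det_mul, Matrix.det_mul, Matrix.det_transpose,
    det_coneGram v hkn he hrange, hcard, ← m₁_add_m₂ hkn, pow_add] at hdet
  simp only [hv2] at hdet
  -- As `m₃ = m₁ + m₂`, the factor `x o ^ m₂` occurs on both sides and cancels.
  have hdet' : x o ^ m₁ n k * G.det = B.det ^ 2 * (∑ i, x i) ^ m₁ n k := by
    have h0 : x o ^ m₂ n k ≠ 0 := (pow_pos (hx o) _).ne'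
    apply mul_right_cancel₀ h0
    linear_combination hdet
  have hAB : B.det * ∏ i, v i ^ (univ.filter fun f => i ∈ e f).card
      = A.det * ∏ i, v i ^ (univ.filter fun f => i ∈ s f).card := by
    rw [← prod_prod_mem_eq, ← prod_prod_mem_eq, mul_comm, ← Matrix.det_mul_column, mul_comm,
      Int.cast_det A, ← Matrix.det_mul_row]
    congr 1
    ext f g
    simp only [Matrix.of_apply, hB, hA, Matrix.submatrix_apply, Matrix.map_apply]
    rw [mul_comm, contraction_apply_mul_prod, ← map_contraction_one, mul_comm]
  have hsq : ∀ c : Fin n → ℕ, (∏ i, v i ^ c i) ^ 2 = ∏ i, x i ^ c i := by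
    intro c
    rw [← Finset.prod_pow]
    refine Finset.prod_congr rfl fun i _ => ?_
    rw [← pow_mul, mul_comm, pow_mul, hv2]
  have hAB2 := congrArg (· ^ 2) hAB
  simp only [mul_pow, hsq] at hAB2
  have hrest : ∏ i, x i ^ m₁ n k
      = x o ^ m₁ n k * ∏ i, x i ^ (univ.filter fun f => i ∈ e f).card := by
    rw [← Finset.mul_prod_erase univ _ (Finset.mem_univ o),
      ← Finset.mul_prod_erase univ (fun i => x i ^ (univ.filter fun f => i ∈ e f).card)
        (Finset.mem_univ o), card_filter_apex_mem hrange, pow_zero, one_mul]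
    congr 1
    refine Finset.prod_congr rfl fun i hi => ?_
    rw [card_filter_mem_eq_m₁ hkn he hrange (Finset.mem_erase.mp hi).1]
  calc _ = (∏ i, x i ^ m₁ n k) * G.det := by
        rw [hrest]
        linear_combination (-(∑ i, x i) ^ m₁ n k) * hAB2
          - (∏ i, x i ^ (univ.filter fun f => i ∈ e f).card) * hdet'
    _ ≤ _ := mul_le_mul_of_nonneg_left hle (Finset.prod_nonneg fun i _ => (pow_pos (hx i) _).le)

end Counting

end QAcyclic

/-! ### Choice of the weights -/

namespace QAcyclic

theorem mul_m₁_add_m₂ {n k : ℕ} (hkn : k < n) : n * m₁ n k + m₂ n k = (k + 1) * m₃ n k := by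
  rcases k with _ | j
  · simp [m₁, m₂, m₃]
  · obtain ⟨m, rfl⟩ : ∃ m, n = m + 2 := ⟨n - 2, by omega⟩
    rw [← m₁_add_m₂ hkn]
    obtain ⟨l, rfl⟩ : ∃ l, m = j + l := ⟨m - j, by omega⟩
    have h := Nat.choose_succ_right_eq (j + l) j
    rw [Nat.add_sub_cancel_left] at h
    simp only [m₁, m₂, Nat.add_sub_cancel]
    linarith

variable {n k : ℕ} {d : Fin n → ℕ} {c : ℤ}

/-- With weight `t` at `i` and `1` elsewhere, the left side is at least `t ^ d i` and the right side
at most a constant times `t ^ m₁`. For small `t` this excludes `d i < m₁`. -/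
theorem m₁_le_of_forall_le (hkn : k < n) (hc : c ≠ 0)
    (h : ∀ x : Fin n → ℝ, (∀ i, 0 < x i) →
      (c : ℝ) ^ 2 * (∑ i, x i) ^ m₁ n k * ∏ i, x i ^ d i
        ≤ (∏ i, x i ^ m₁ n k) * ((∑ i, (d i : ℝ) * x i) / m₃ n k) ^ m₃ n k) (i : Fin n) :
    m₁ n k ≤ d i := by
  by_contra! hlt
  -- A second vertex keeps the sum of the weights at least `1`; with a single vertex `m₁ = 0` and
  -- `hlt` is absurd.
  have hn : ∃ j, j ≠ i := by
    by_contra! hall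
    have h1 : n ≤ 1 := by
      by_contra! h2
      have := (hall ⟨0, by omega⟩).trans (hall ⟨1, by omega⟩).symm
      simp at this
    obtain rfl : k = 0 := by omega
    exact absurd hlt (Nat.not_lt_zero _)
  obtain ⟨j, hj⟩ := hn
  set C : ℝ := ((∑ i, (d i : ℝ)) / m₃ n k) ^ m₃ n k with hC
  have hC0 : 0 ≤ C := by positivity
  -- Chosen so that `t * C < 1`.
  set t : ℝ := 1 / (C + 1) with ht
  have ht0 : 0 < t := by positivity
  have ht1 : t ≤ 1 := by rw [ht, div_le_one (by positivity)]; linarith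
  set x : Fin n → ℝ := Function.update 1 i t with hx
  have hx0 : ∀ l, 0 < x l := by
    intro l
    rcases eq_or_ne l i with rfl | hl
    · simpa [hx] using ht0
    · simp [hx, hl]
  have hx1 : ∀ l, x l ≤ 1 := by
    intro l
    rcases eq_or_ne l i with rfl | hl
    · simpa [hx] using ht1
    · simp [hx, hl]
  have hprod : ∀ a : Fin n → ℕ, ∏ l, x l ^ a l = t ^ a i := by
    intro a
    rw [Finset.prod_eq_single i]
    · simp [hx]
    · intro l _ hl; simp [hx, hl]
    · simp
  have hS : 1 ≤ ∑ l, x l := by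
    calc (1 : ℝ) = x j := by simp [hx, hj]
      _ ≤ _ := Finset.single_le_sum (fun l _ => (hx0 l).le) (Finset.mem_univ j)
  have hc1 : (1 : ℝ) ≤ (c : ℝ) ^ 2 := by
    have : 1 ≤ c ^ 2 := by
      have := sq_pos_of_ne_zero hc
      omega
    exact_mod_cast this
  have h1 := h x hx0
  rw [hprod, hprod] at h1
  have h2 : t ^ d i ≤ t ^ m₁ n k * C := by
    calc t ^ d i = 1 * t ^ d i := (one_mul _).symm
      _ ≤ (c : ℝ) ^ 2 * (∑ i, x i) ^ m₁ n k * t ^ d i := by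
        refine mul_le_mul_of_nonneg_right ?_ (by positivity)
        exact one_le_mul_of_one_le_of_one_le hc1 (one_le_pow₀ hS)
      _ ≤ _ := h1
      _ ≤ _ := by
        refine mul_le_mul_of_nonneg_left ?_ (by positivity)
        have h0 : 0 ≤ ∑ l, (d l : ℝ) * x l :=
          Finset.sum_nonneg fun l _ => mul_nonneg (by positivity) (hx0 l).le
        rw [hC]
        gcongr with l
        exact mul_le_of_le_one_right (by positivity) (hx1 l)
  have h3 : t ^ m₁ n k ≤ t ^ d i * t := by
    rw [← pow_succ]
    exact pow_le_pow_of_le_one ht0.le ht1 hlt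
  have h4 : t ^ d i * 1 ≤ t ^ d i * (t * C) := by
    calc _ ≤ _ := by rw [mul_one]; exact h2
      _ ≤ t ^ d i * t * C := mul_le_mul_of_nonneg_right h3 hC0
      _ = _ := by ring
  have h5 := le_of_mul_le_mul_left h4 (by positivity)
  rw [ht, one_div, inv_mul_eq_div, le_div_iff₀ (by positivity)] at h5
  linarith

/-- The weights `d i - m₁` may vanish. Once `∏ i, x i ^ m₁` is cancelled both sides are continuous,
so the inequality passes to the limit `x i + ε → x i`. -/
theorem forall_nonneg_le_of_forall_pos_le (hd : ∀ i, m₁ n k ≤ d i)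
    (h : ∀ x : Fin n → ℝ, (∀ i, 0 < x i) →
      (c : ℝ) ^ 2 * (∑ i, x i) ^ m₁ n k * ∏ i, x i ^ d i
        ≤ (∏ i, x i ^ m₁ n k) * ((∑ i, (d i : ℝ) * x i) / m₃ n k) ^ m₃ n k)
    {x : Fin n → ℝ} (hx : ∀ i, 0 ≤ x i) :
    (c : ℝ) ^ 2 * (∑ i, x i) ^ m₁ n k * ∏ i, x i ^ (d i - m₁ n k)
      ≤ ((∑ i, (d i : ℝ) * x i) / m₃ n k) ^ m₃ n k := by
  have hpos : ∀ x : Fin n → ℝ, (∀ i, 0 < x i) →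
      (c : ℝ) ^ 2 * (∑ i, x i) ^ m₁ n k * ∏ i, x i ^ (d i - m₁ n k)
        ≤ ((∑ i, (d i : ℝ) * x i) / m₃ n k) ^ m₃ n k := by
    intro x hx
    have h0 : 0 < ∏ i, x i ^ m₁ n k := Finset.prod_pos fun i _ => pow_pos (hx i) _
    have h1 : ∏ i, x i ^ d i = (∏ i, x i ^ m₁ n k) * ∏ i, x i ^ (d i - m₁ n k) := by
      rw [← Finset.prod_mul_distrib]
      refine Finset.prod_congr rfl fun i _ => ?_
      rw [← pow_add, Nat.add_sub_cancel' (hd i)]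
    refine le_of_mul_le_mul_left ?_ h0
    refine le_trans (le_of_eq ?_) (h x hx)
    rw [h1]; ring
  have hl : Continuous fun ε : ℝ => (c : ℝ) ^ 2 * (∑ i, (x i + ε)) ^ m₁ n k
      * ∏ i, (x i + ε) ^ (d i - m₁ n k) := by fun_prop
  have hr : Continuous fun ε : ℝ => ((∑ i, (d i : ℝ) * (x i + ε)) / m₃ n k) ^ m₃ n k := by
    fun_prop
  have h1 := (hl.tendsto 0).mono_left (nhdsWithin_le_nhds (s := Set.Ioi 0))
  have h2 := (hr.tendsto 0).mono_left (nhdsWithin_le_nhds (s := Set.Ioi 0))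
  have h3 := le_of_tendsto_of_tendsto h1 h2 (by
    filter_upwards [self_mem_nhdsWithin] with ε hε
    exact hpos _ fun i => add_pos_of_nonneg_of_pos (hx i) hε)
  simpa using h3

theorem sq_le_of_forall_pos_le (hkn : k < n) (hm₂ : m₂ n k ≠ 0) (hc : c ≠ 0)
    (hsum : ∑ i, d i = (k + 1) * m₃ n k)
    (h : ∀ x : Fin n → ℝ, (∀ i, 0 < x i) →
      (c : ℝ) ^ 2 * (∑ i, x i) ^ m₁ n k * ∏ i, x i ^ d i
        ≤ (∏ i, x i ^ m₁ n k) * ((∑ i, (d i : ℝ) * x i) / m₃ n k) ^ m₃ n k) :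
    (c : ℝ) ^ 2 ≤ (∏ i, ((d i : ℝ) - (m₁ n k : ℝ)) ^ ((m₁ n k : ℤ) - (d i : ℤ)))
        / (m₂ n k : ℝ) ^ m₁ n k
      * ((∑ i, (d i : ℝ) ^ 2) / (m₃ n k : ℝ) - ((k : ℝ) + 1) * (m₁ n k : ℝ)) ^ m₃ n k := by
  have hd := m₁_le_of_forall_le hkn hc h
  have hm₃ : (m₃ n k : ℝ) ≠ 0 := by exact_mod_cast (Nat.choose_pos (by omega)).ne'
  have hsum' : ∑ i, (d i : ℝ) = (k + 1) * m₃ n k := by exact_mod_cast hsum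
  have hmain := forall_nonneg_le_of_forall_pos_le hd h (x := fun i => (d i : ℝ) - m₁ n k)
    (fun i => by rw [sub_nonneg]; exact_mod_cast hd i)
  have e1 : ∑ i, ((d i : ℝ) - m₁ n k) = m₂ n k := by
    have : (n : ℝ) * m₁ n k + m₂ n k = (k + 1) * m₃ n k := by exact_mod_cast mul_m₁_add_m₂ hkn
    rw [Finset.sum_sub_distrib, hsum', Finset.sum_const, Finset.card_univ, Fintype.card_fin,
      nsmul_eq_mul]
    linarith
  have e2 : (∑ i, (d i : ℝ) * ((d i : ℝ) - m₁ n k)) / m₃ n k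
      = (∑ i, (d i : ℝ) ^ 2) / (m₃ n k : ℝ) - ((k : ℝ) + 1) * (m₁ n k : ℝ) := by
    simp only [mul_sub, ← pow_two, Finset.sum_sub_distrib, ← Finset.sum_mul, hsum']
    field_simp
  -- When `d i = m₁` the factor is `0 ^ 0 = 1`, so the product can still be inverted.
  have hfac : ∀ i, 0 < ((d i : ℝ) - m₁ n k) ^ (d i - m₁ n k) := by
    intro i
    rcases (hd i).eq_or_lt with h0 | h0
    · rw [← h0]; simp
    · exact pow_pos (by rw [sub_pos]; exact_mod_cast h0) _
  have e3 : ∏ i, ((d i : ℝ) - (m₁ n k : ℝ)) ^ ((m₁ n k : ℤ) - (d i : ℤ))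
      = (∏ i, ((d i : ℝ) - m₁ n k) ^ (d i - m₁ n k))⁻¹ := by
    rw [← Finset.prod_inv_distrib]
    refine Finset.prod_congr rfl fun i _ => ?_
    rw [← zpow_natCast, ← _root_.zpow_neg, Nat.cast_sub (hd i), neg_sub]
  rw [e1, e2] at hmain
  have hP : 0 < ∏ i, ((d i : ℝ) - m₁ n k) ^ (d i - m₁ n k) := Finset.prod_pos fun i _ => hfac i
  have hM : 0 < (m₂ n k : ℝ) ^ m₁ n k := pow_pos (by exact_mod_cast Nat.pos_of_ne_zero hm₂) _
  rw [e3, ← one_div, div_div, one_div, inv_mul_eq_div, le_div_iff₀ (mul_pos hP hM)]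
  linarith

end QAcyclic

/-! ### The order of the homology group as a determinant -/

namespace QAcyclic

variable {n k : ℕ} {T : PreAbstractSimplicialComplex (Fin n)}

theorem boundary_apply (x : Finset (Fin n) →₀ ℤ) :
    ⇑(boundary n x) = contraction (1 : Fin n → ℤ) *ᵥ ⇑x := by
  induction x using Finsupp.induction_linear with
  | zero => simp
  | add f g hf hg => simp [hf, hg, Matrix.mulVec_add]
  | single σ c =>
    ext τ
    rw [boundary_single, Matrix.mulVec, dotProduct, Finset.sum_eq_single σ]
    · simp [contraction_apply, Finsupp.single_apply, mul_comm]
    · intro ρ _ hρ; simp [Finsupp.single_eq_of_ne hρ]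
    · simp

/-- Coning from `o`, which is `(removal ℤ o)ᵀ`, is a chain homotopy from the identity to zero on the
full simplex. -/
theorem contraction_one_mulVec_add (o : Fin n) (u : Finset (Fin n) → ℤ) :
    contraction (1 : Fin n → ℤ) *ᵥ ((removal ℤ o)ᵀ *ᵥ u)
      + (removal ℤ o)ᵀ *ᵥ (contraction (1 : Fin n → ℤ) *ᵥ u) = u := by
  rw [Matrix.mulVec_mulVec, Matrix.mulVec_mulVec, ← Matrix.add_mulVec,
    contraction_mul_removal_transpose_add]
  simp

theorem mem_chains_iff {j : ℕ} {x : Finset (Fin n) →₀ ℤ} :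
    x ∈ chains T j ↔ ∀ τ, τ ∉ facesOfCard T j → x τ = 0 := by
  rw [chains, Finsupp.mem_supported']

/-- A cycle is the boundary of its cone from `o`, and the cone sees only faces avoiding `o`. -/
theorem eq_zero_of_mem_cycles (o : Fin n) {j : ℕ} {x : Finset (Fin n) →₀ ℤ} (hx : x ∈ cycles T j)
    (h : ∀ τ, τ.card = j → o ∉ τ → x τ = 0) : x = 0 := by
  have h1 := contraction_one_mulVec_add o x
  rw [← boundary_apply, LinearMap.mem_ker.mp hx.2] at h1
  have h2 : (removal ℤ o)ᵀ *ᵥ ⇑x = 0 := by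
    ext σ
    rw [Matrix.mulVec, dotProduct]
    refine Finset.sum_eq_zero fun τ _ => ?_
    rw [Matrix.transpose_apply, removal, Matrix.of_apply]
    split_ifs with hσ
    · by_cases hτ : τ.card = j
      · rw [h τ hτ (by rw [← hσ.2]; simp), mul_zero]
      · rw [mem_chains_iff.mp hx.1 τ (fun h' => hτ h'.1), mul_zero]
    · rw [zero_mul]
  rw [h2] at h1
  exact DFunLike.coe_injective (by simpa using h1.symm)

namespace IsQAcyclic

theorem mem_facesOfCard_iff (hT : IsQAcyclic k T) {τ : Finset (Fin n)} :
    τ ∈ facesOfCard T k ↔ τ.card = k := by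
  refine ⟨fun h => h.1, fun h => ⟨h, ?_⟩⟩
  rcases τ.eq_empty_or_nonempty with h0 | h0
  · exact Or.inl h0
  · exact Or.inr (hT.full_skeleton τ h0 h.le)

theorem cycles_eq_bot (hT : IsQAcyclic k T) : cycles T (k + 1) = ⊥ := by
  have h1 := hT.homology_eq_zero
  rw [Submodule.Quotient.subsingleton_iff, Submodule.submoduleOf_eq_top] at h1
  rw [eq_bot_iff]
  refine h1.trans ?_
  rintro _ ⟨y, hy, rfl⟩
  have : y = 0 := by
    ext σ
    refine mem_chains_iff.mp hy σ fun hσ => ?_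
    rcases hσ.2 with h | h
    · have := hσ.1; simp [h] at this
    · have := hT.card_le σ h
      have := hσ.1
      omega
  simp [this]

end IsQAcyclic

/-- The cycle is the boundary of the cone over `w`. The cone need not lie in `T`, but its boundary
does because the `(k - 1)`-skeleton is full. -/
theorem exists_mem_cycles_forall_eq (hT : IsQAcyclic k T) (o : Fin n)
    (w : Finset (Fin n) → ℤ) :
    ∃ z ∈ cycles T k, ∀ τ, τ.card = k → o ∉ τ → z τ = w τ := by
  classical
  set W : Finset (Fin n) → ℤ := fun τ => if τ.card = k then w τ else 0
  set y : Finset (Fin n) →₀ ℤ := Finsupp.equivFunOnFinite.symm ((removal ℤ o)ᵀ *ᵥ W)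
  have hyc : ⇑y = (removal ℤ o)ᵀ *ᵥ W := rfl
  have hy0 : ∀ σ, σ.card ≠ k + 1 → y σ = 0 := by
    intro σ hσ
    rw [hyc]
    rw [Matrix.mulVec, dotProduct]
    refine Finset.sum_eq_zero fun τ _ => ?_
    by_cases hτ : τ.card = k
    · rw [Matrix.transpose_apply, ← contraction_single, contraction_apply_eq_zero _ (by omega),
        zero_mul]
    · simp [W, hτ]
  refine ⟨boundary n y, ⟨?_, boundary_boundary y⟩, ?_⟩
  · refine mem_chains_iff.mpr fun τ hτ => ?_
    rw [hT.mem_facesOfCard_iff] at hτ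
    rw [boundary_apply]
    rw [Matrix.mulVec, dotProduct]
    refine Finset.sum_eq_zero fun σ _ => ?_
    by_cases hσ : σ.card = k + 1
    · rw [contraction_apply_eq_zero _ (by omega), zero_mul]
    · rw [hy0 σ hσ, mul_zero]
  · intro τ hτ ho
    have h1 := congrFun (contraction_one_mulVec_add o W) τ
    rw [← hyc, ← boundary_apply, Pi.add_apply] at h1
    have h2 : ((removal ℤ o)ᵀ *ᵥ (contraction (1 : Fin n → ℤ) *ᵥ W)) τ = 0 := by
      rw [Matrix.mulVec, dotProduct]
      refine Finset.sum_eq_zero fun ρ _ => ?_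
      rw [Matrix.transpose_apply, removal, Matrix.of_apply, if_neg (fun h => ho h.1), zero_mul]
    rw [h2, add_zero] at h1
    rw [h1]
    simp [W, hτ]

section Determinant

variable {F : Type*} [Fintype F] {o : Fin n} {e s : F → Finset (Fin n)}

theorem exists_mem_chains_comp_eq (hs : Function.Injective s)
    (hsrange : Set.range s = facesOfCard T (k + 1)) (w : F → ℤ) :
    ∃ y ∈ chains T (k + 1), ∀ f, y (s f) = w f := by
  refine ⟨Finsupp.mapDomain s (Finsupp.equivFunOnFinite.symm w), mem_chains_iff.mpr ?_, ?_⟩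
  · intro τ hτ
    rw [← hsrange] at hτ
    exact Finsupp.mapDomain_of_notMem_range _ _ hτ
  · intro f
    rw [Finsupp.mapDomain_apply hs]; rfl

theorem boundary_comp_eq (hs : Function.Injective s)
    (hsrange : Set.range s = facesOfCard T (k + 1)) {y : Finset (Fin n) →₀ ℤ}
    (hy : y ∈ chains T (k + 1)) :
    ⇑(boundary n y) ∘ e = (contraction (1 : Fin n → ℤ)).submatrix e s *ᵥ (⇑y ∘ s) := by
  ext f
  rw [boundary_apply]
  symm
  refine Fintype.sum_of_injective s hs _ _ (fun τ hτ => ?_) (fun _ => rfl)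
  rw [hsrange] at hτ
  rw [mem_chains_iff.mp hy τ hτ, mul_zero]

/-- A kernel vector is a `k`-chain whose boundary vanishes on sets avoiding `o`, hence everywhere;
it is then a `k`-cycle of `T`, and these are zero. -/
theorem det_ne_zero [DecidableEq F] (hT : IsQAcyclic k T)
    (hrange : ∀ τ, τ ∈ Set.range e ↔ τ.card = k ∧ o ∉ τ) (hs : Function.Injective s)
    (hsrange : Set.range s = facesOfCard T (k + 1)) :
    ((contraction (1 : Fin n → ℤ)).submatrix e s).det ≠ 0 := by
  intro h0
  obtain ⟨w, hw, hAw⟩ := Matrix.exists_mulVec_eq_zero_iff.mpr h0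
  obtain ⟨y, hy, hyw⟩ := exists_mem_chains_comp_eq hs hsrange w
  have hyw' : ⇑y ∘ s = w := funext hyw
  have h1 := boundary_comp_eq (e := e) hs hsrange hy
  rw [hyw', hAw] at h1
  have h2 : boundary n y = 0 := by
    refine eq_zero_of_mem_cycles (T := T) o (j := k)
      (boundaries_le_cycles T k ⟨y, hy, rfl⟩) fun τ hτ ho => ?_
    obtain ⟨f, rfl⟩ := (hrange τ).mpr ⟨hτ, ho⟩
    exact congrFun h1 f
  have h3 : y ∈ cycles T (k + 1) := ⟨hy, h2⟩
  rw [hT.cycles_eq_bot, Submodule.mem_bot] at h3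
  exact hw (by rw [← hyw', h3]; rfl)

/-- Restriction to the sets avoiding `o` maps the cycles isomorphically onto `F → ℤ` and the
boundaries onto the column lattice of `A`, whose index is `|det A|`. -/
theorem card_reducedHomology [DecidableEq F] (hT : IsQAcyclic k T) (he : Function.Injective e)
    (hrange : ∀ τ, τ ∈ Set.range e ↔ τ.card = k ∧ o ∉ τ) (hs : Function.Injective s)
    (hsrange : Set.range s = facesOfCard T (k + 1)) :
    Nat.card (ReducedHomology T k)
      = (((contraction (1 : Fin n → ℤ)).submatrix e s).det).natAbs := by
  set A := (contraction (1 : Fin n → ℤ)).submatrix e s with hA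
  set r : cycles T k →ₗ[ℤ] (F → ℤ) :=
    (LinearMap.funLeft ℤ ℤ e).comp (Finsupp.lcoeFun.comp (cycles T k).subtype) with hr
  have hr_apply : ∀ x, r x = ⇑(x : Finset (Fin n) →₀ ℤ) ∘ e := fun _ => rfl
  have hbij : Function.Bijective r := by
    constructor
    · rw [← LinearMap.ker_eq_bot, LinearMap.ker_eq_bot']
      intro x hx
      refine Subtype.ext (eq_zero_of_mem_cycles o x.2 fun τ hτ ho => ?_)
      obtain ⟨f, rfl⟩ := (hrange τ).mpr ⟨hτ, ho⟩
      exact congrFun hx f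
    · intro w
      obtain ⟨z, hz, hzw⟩ := exists_mem_cycles_forall_eq hT o (Function.extend e w 0)
      refine ⟨⟨z, hz⟩, funext fun f => ?_⟩
      have hf := (hrange (e f)).mp ⟨f, rfl⟩
      rw [hr_apply, Function.comp_apply, hzw _ hf.1 hf.2, he.extend_apply]
  have hmap : ((boundaries T k).submoduleOf (cycles T k)).map
      (LinearEquiv.ofBijective r hbij : cycles T k →ₗ[ℤ] (F → ℤ)) = LinearMap.range A.mulVecLin := by
    ext w
    constructor
    · rintro ⟨x, ⟨y, hy, hyx⟩, rfl⟩
      refine ⟨⇑y ∘ s, ?_⟩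
      rw [Matrix.mulVecLin_apply, hA, ← boundary_comp_eq hs hsrange hy, hyx]
      rfl
    · rintro ⟨u, rfl⟩
      obtain ⟨y, hy, hyu⟩ := exists_mem_chains_comp_eq hs hsrange u
      refine ⟨⟨boundary n y, boundaries_le_cycles T k ⟨y, hy, rfl⟩⟩, ⟨y, hy, rfl⟩, ?_⟩
      rw [Matrix.mulVecLin_apply, ← funext hyu]
      exact boundary_comp_eq hs hsrange hy
  have hinj : Function.Injective A.mulVecLin := by
    rw [← LinearMap.ker_eq_bot, LinearMap.ker_eq_bot']
    intro u hu
    by_contra hu0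
    exact det_ne_zero hT hrange hs hsrange (Matrix.exists_mulVec_eq_zero_iff.mp ⟨u, hu0, hu⟩)
  rw [Nat.card_congr (Submodule.Quotient.equiv _ _ (LinearEquiv.ofBijective r hbij) hmap).toEquiv,
    ← Submodule.natAbs_det_equiv _ (LinearEquiv.ofInjective A.mulVecLin hinj),
    ← LinearMap.det_toLin']
  rfl

end Determinant

theorem exists_natAbs_eq_card_reducedHomology (hkn : k < n) (hT : IsQAcyclic k T) :
    ∃ c : ℤ, c ≠ 0 ∧ Nat.card (ReducedHomology T k) = c.natAbs ∧
      ∑ i, degree k T i = (k + 1) * m₃ n k ∧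
      ∀ x : Fin n → ℝ, (∀ i, 0 < x i) →
        (c : ℝ) ^ 2 * (∑ i, x i) ^ m₁ n k * ∏ i, x i ^ degree k T i
          ≤ (∏ i, x i ^ m₁ n k) * ((∑ i, (degree k T i : ℝ) * x i) / m₃ n k) ^ m₃ n k := by
  classical
  set o : Fin n := ⟨0, by omega⟩
  let F := {σ // σ ∈ facesOfCard T (k + 1)}
  let N := {τ : Finset (Fin n) // τ.card = k ∧ o ∉ τ}
  have hN : Fintype.card N = m₃ n k :=
    card_eq_m₃ (o := o) (e := (Subtype.val : N → _)) Subtype.val_injective (by simp [N])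
  have hF : Fintype.card F = m₃ n k := by
    rw [m₃, ← hT.card_faces, ← Nat.card_eq_fintype_card]; rfl
  -- An arbitrary bijection lets faces index the rows too; it affects the determinant only by a
  -- sign.
  obtain ⟨E⟩ := Fintype.card_eq.mp (hF.trans hN.symm)
  let e : F → Finset (Fin n) := fun f => (E f).1
  let s : F → Finset (Fin n) := Subtype.val
  have he : Function.Injective e := Subtype.val_injective.comp E.injective
  have hrange : ∀ τ, τ ∈ Set.range e ↔ τ.card = k ∧ o ∉ τ := by
    intro τ
    constructor
    · rintro ⟨f, rfl⟩; exact (E f).2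
    · intro h; exact ⟨E.symm ⟨τ, h⟩, by simp [e]⟩
  have hs : Function.Injective s := Subtype.val_injective
  have hsrange : Set.range s = facesOfCard T (k + 1) := Subtype.range_coe
  have hdeg : ∀ i, degree k T i = (univ.filter fun f => i ∈ s f).card := by
    intro i
    rw [degree, ← Finset.card_image_of_injective _ hs, ← Set.ncard_coe_finset]
    congr 1
    ext σ
    simp only [Set.mem_ofPred_eq, Finset.coe_image, Set.mem_image, Finset.coe_filter,
      Finset.mem_univ, true_and]
    exact ⟨fun h => ⟨⟨σ, h.1⟩, h.2, rfl⟩, by rintro ⟨f, hf, rfl⟩; exact ⟨f.2, hf⟩⟩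
  refine ⟨_, det_ne_zero hT hrange hs hsrange, card_reducedHomology hT he hrange hs hsrange, ?_,
    fun x hx => ?_⟩
  · have h := sum_sum_mem_eq s (1 : Fin n → ℝ)
    simp only [Pi.one_apply, mul_one, ← hdeg, Finset.sum_const, nsmul_eq_mul] at h
    rw [Finset.sum_congr rfl fun (f : F) _ => by rw [show (s f).card = k + 1 from f.2.1],
      Finset.sum_const, Finset.card_univ, hF, nsmul_eq_mul] at h
    rw [mul_comm]
    exact_mod_cast h.symm
  · simp only [hdeg]
    exact det_sq_mul_le hkn he hrange (fun f => f.2.1) hx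

end QAcyclic

end

/-- Given `k < n`, the condition `hm₂` says exactly that `n ≥ k + 2` or `(n, k) = (1, 0)`. -/
theorem corollary4 (n k : ℕ) (hkn : k < n) (hm₂ : QAcyclic.m₂ n k ≠ 0)
    (T : PreAbstractSimplicialComplex (Fin n)) (hT : QAcyclic.IsQAcyclic k T) :
    Finite (QAcyclic.ReducedHomology T k) ∧
      (Nat.card (QAcyclic.ReducedHomology T k) : ℝ) ^ 2 ≤
        (∏ i : Fin n, ((QAcyclic.degree k T i : ℝ) - (QAcyclic.m₁ n k : ℝ)) ^
            ((QAcyclic.m₁ n k : ℤ) - (QAcyclic.degree k T i : ℤ))) /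
          (QAcyclic.m₂ n k : ℝ) ^ QAcyclic.m₁ n k *
        ((∑ i : Fin n, (QAcyclic.degree k T i : ℝ) ^ 2) / (QAcyclic.m₃ n k : ℝ) -
          ((k : ℝ) + 1) * (QAcyclic.m₁ n k : ℝ)) ^ QAcyclic.m₃ n k := by
  obtain ⟨c, hc, hcard, hsum, hle⟩ :=
    QAcyclic.exists_natAbs_eq_card_reducedHomology hkn hT
  -- `Nat.card` is `0` on infinite types, so a nonzero value gives finiteness.
  refine ⟨Nat.finite_of_card_ne_zero (by rw [hcard]; exact Int.natAbs_ne_zero.mpr hc), ?_⟩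
  rw [hcard, Nat.cast_natAbs, Int.cast_abs, sq_abs]
  exact QAcyclic.sq_le_of_forall_pos_le hkn hm₂ hc hsum hle
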